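/- Let $0<a\le b$, $\kappa=b/a$, and let $A,-B\in\mathbb C^{n\times n}$ be Hermitian positive definite with spectra contained in $[a,b]$. Let $I_A\subseteq[a,b]$ and $I_B\subseteq[-b,-a]$ be closed intervals containing the spectra of $A$ and $B$, respectively (for instance $I_A=[a,b]$, $I_B=[-b,-a]$). Let $F=U_FV_F^T$ with $U_F,V_F\in\mathbb C^{n\times k}$. For a tuple $\Sigma=(\sigma_1,\dots,\sigma_\ell)$ of points of $\overline{\mathbb C}=\mathbb C\cup\{\infty\}$ put $q_\Sigma(z)=\prod_{\sigma_j\ne\infty}(z-\sigma_j)$. If no finite $\sigma_j$ is an eigenvalue of $M\in\mathbb C^{n\times n}$, let $\mathcal{RK}_\ell(M,W,\Sigma)\subseteq\mathbb C^n$ be the span of the columns of all the blocks $q_\Sigma(M)^{-1}M^jW$, $0\le j\le\ell$. Let $$\theta_\ell(I_1,I_2,\Sigma)=\inf_{r}\frac{\max_{z\in I_1}|r(z)|}{\min_{z\in I_2}|r(z)|},$$ where $r$ ranges over the rational functions $g/q_\Sigma$ with $g$ a polynomial of degree at most $\ell$, in lowest terms and with $|r|=\infty$ at the poles of $r$, such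 that $r$ has no pole in $I_1$ and no zero in $I_2$. Let $\Psi,\Xi$ be $\ell$-tuples of points of $\overline{\mathbb C}$ whose finite entries are not eigenvalues of $A$, respectively of $B$. Let the columns of $U$ and of $V$ be orthonormal bases of $\mathcal{RK}_\ell(A,U_F,\Psi)$ and $\mathcal{RK}_\ell(B^T,V_F,\Xi)$, respectively. Let $X_\ell=UYV^T$ be the Galerkin approximation to the solution of $AX-XB=F$ from the tensorized subspace, that is, $Y$ solves the projected equation $$(U^*AU)\,Y-Y\,(V^TB\overline V)=U^*F\,\overline V .$$ Then, in the spectral norm, $$\|AX_\ell-X_\ell B-F\|_2\le(1+\kappa)\max\{\theta_\ell(I_A,I_B,\Psi),\ \theta_\ell(I_B,I_A,\Xi)\}\,\|F\|_2 .$$ -/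

import Mathlib

open Matrix Polynomial
open scoped ENNReal ComplexOrder Kronecker RatFunc Matrix.Norms.L2Operator

noncomputable section

namespace GalerkinSylvester

/-- The polynomial with the finite poles as its roots (with multiplicity):
the product of `X - σ j` over all `j` with `σ j ≠ ∞`. -/
def polePoly {ℓ : ℕ} (σ : Fin ℓ → OnePoint ℂ) : ℂ[X] :=
  ∏ j, (σ j).elim 1 (fun s => X - C s)

/-- The block rational Krylov subspace `q(A)⁻¹ span {v, A v, …, A ^ ℓ v}`, where `q` is the
polynomial of the finite poles and the span is over all columns of the blocks.
It is meaningful when no pole is an eigenvalue of `A`. -/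
def rationalKrylov {n k ℓ : ℕ} (A : Matrix (Fin n) (Fin n) ℂ) (v : Matrix (Fin n) (Fin k) ℂ)
    (σ : Fin ℓ → OnePoint ℂ) : Submodule ℂ (Fin n → ℂ) :=
  Submodule.span ℂ
    {w | ∃ j ≤ ℓ, ∃ c : Fin k, w = ((aeval A (polePoly σ))⁻¹ * A ^ j * v).col c}

/-- No pole in `σ` lies in the spectrum of `A`. -/
def PolesAdmissible {n ℓ : ℕ} (A : Matrix (Fin n) (Fin n) ℂ) (σ : Fin ℓ → OnePoint ℂ) : Prop :=
  ∀ j, ∀ s : ℂ, σ j = (s : OnePoint ℂ) → s ∉ spectrum ℂ A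

/-- The columns of `W` form an orthonormal basis of the subspace `S`. -/
def IsOrthonormalBasisOf {n m : ℕ} (W : Matrix (Fin n) (Fin m) ℂ)
    (S : Submodule ℂ (Fin n → ℂ)) : Prop :=
  Wᴴ * W = 1 ∧ Submodule.span ℂ (Set.range W.col) = S

/-- The rational functions `g / l` with `deg g ≤ ℓ`, where `l` is the polynomial of the finite
poles. -/
def ratClass {ℓ : ℕ} (σ : Fin ℓ → OnePoint ℂ) : Set ℂ⟮X⟯ :=
  {r | ∃ g : ℂ[X], g.natDegree ≤ ℓ ∧
    r = algebraMap ℂ[X] ℂ⟮X⟯ g / algebraMap ℂ[X] ℂ⟮X⟯ (polePoly σ)}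

/-- The modulus `|r z| ∈ [0, ∞]`. As `r.num` and `r.denom` are coprime, the quotient is `∞` exactly
at the poles of `r`, and common factors have been cancelled. -/
def ratAbs (r : ℂ⟮X⟯) (z : ℂ) : ℝ≥0∞ :=
  ‖r.num.eval z‖ₑ / ‖r.denom.eval z‖ₑ

/-- The infimum over all `r` in `ratClass σ` of `max_{I₁} |r| / min_{I₂} |r|`, as an element of
`[0, ∞]`. Functions `r` with a pole in `I₁` or a zero in `I₂` never contribute: their quotient is
infinite, or of the indeterminate form `0 / 0` or `∞ / ∞`. -/
def thetaENN {ℓ : ℕ} (I₁ I₂ : Set ℂ) (σ : Fin ℓ → OnePoint ℂ) : ℝ≥0∞ :=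
  ⨅ r ∈ {r ∈ ratClass σ | (⨆ z ∈ I₁, ratAbs r z) ≠ ∞ ∧ (⨅ z ∈ I₂, ratAbs r z) ≠ 0},
    (⨆ z ∈ I₁, ratAbs r z) / (⨅ z ∈ I₂, ratAbs r z)

theorem polePoly_ne_zero {ℓ : ℕ} (σ : Fin ℓ → OnePoint ℂ) : polePoly σ ≠ 0 := by
  refine Finset.prod_ne_zero_iff.mpr fun j _ => ?_
  induction σ j using OnePoint.rec with
  | infty => simp
  | coe s => exact X_sub_C_ne_zero s

theorem natDegree_polePoly_le {ℓ : ℕ} (σ : Fin ℓ → OnePoint ℂ) : (polePoly σ).natDegree ≤ ℓ := by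
  refine (natDegree_prod_le _ _).trans ?_
  refine (Finset.sum_le_card_nsmul Finset.univ _ 1 fun j _ => ?_).trans (by simp)
  induction σ j using OnePoint.rec with
  | infty => simp
  | coe s => exact (natDegree_X_sub_C s).le

theorem one_mem_ratClass {ℓ : ℕ} (σ : Fin ℓ → OnePoint ℂ) : (1 : ℂ⟮X⟯) ∈ ratClass σ := by
  refine ⟨polePoly σ, natDegree_polePoly_le σ, (div_self ?_).symm⟩
  simpa using polePoly_ne_zero σ

/-- The constant function `1` is always a competitor, so the infimum is at most `1`; in particular
it is finite. -/
theorem thetaENN_le_one {ℓ : ℕ} (I₁ I₂ : Set ℂ) (σ : Fin ℓ → OnePoint ℂ) :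
    thetaENN I₁ I₂ σ ≤ 1 := by
  have h : ∀ z, ratAbs 1 z = 1 := fun z => by simp [ratAbs]
  have h₁ : (⨆ z ∈ I₁, ratAbs 1 z) ≤ 1 := iSup₂_le fun z _ => (h z).le
  have h₂ : 1 ≤ (⨅ z ∈ I₂, ratAbs 1 z) := le_iInf₂ fun z _ => (h z).ge
  have h₃ : (⨆ z ∈ I₁, ratAbs 1 z) ≠ ∞ := (h₁.trans_lt ENNReal.one_lt_top).ne
  have h₄ : (⨅ z ∈ I₂, ratAbs 1 z) ≠ 0 := (zero_lt_one.trans_le h₂).ne'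
  have h₅ : (⨆ z ∈ I₁, ratAbs 1 z) / (⨅ z ∈ I₂, ratAbs 1 z) ≤ 1 :=
    ENNReal.div_le_of_le_mul ((h₁.trans h₂).trans (one_mul _).ge)
  exact (iInf₂_le (1 : ℂ⟮X⟯) ⟨one_mem_ratClass σ, h₃, h₄⟩).trans h₅

/-- The real number `θ_ℓ(I₁, I₂, σ)`. -/
def theta {ℓ : ℕ} (I₁ I₂ : Set ℂ) (σ : Fin ℓ → OnePoint ℂ) : ℝ :=
  (thetaENN I₁ I₂ σ).toReal

/-- The real interval `[s, t]` as a subset of `ℂ`. -/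
def realInterval (s t : ℝ) : Set ℂ := Complex.ofReal '' Set.Icc s t

/-- The coefficient matrix `I ⊗ A - Bᵀ ⊗ I` of the operator `X ↦ A X - X B` acting on the
column-stacking vectorization `Matrix.vec X`. -/
def sylvesterMatrix {m₁ m₂ : ℕ} (A : Matrix (Fin m₁) (Fin m₁) ℂ) (B : Matrix (Fin m₂) (Fin m₂) ℂ) :
    Matrix (Fin m₂ × Fin m₁) (Fin m₂ × Fin m₁) ℂ :=
  (1 : Matrix (Fin m₂) (Fin m₂) ℂ) ⊗ₖ A - Bᵀ ⊗ₖ (1 : Matrix (Fin m₁) (Fin m₁) ℂ)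

/-- The inverse of `Matrix.vec`. -/
def unvec {m₁ m₂ : ℕ} (y : Fin m₂ × Fin m₁ → ℂ) : Matrix (Fin m₁) (Fin m₂) ℂ :=
  Matrix.of fun i j => y (j, i)

/-- The Galerkin approximation to the solution of `A X - X B = UF VFᵀ` from the tensorized subspace
with orthonormal basis `V ⊗ U` (in the `vec` ordering), that is, `vec (U Y Vᵀ) = (V ⊗ U) vec Y`:
`M = I ⊗ A - Bᵀ ⊗ I` is compressed to
`(V ⊗ U)ᴴ M (V ⊗ U) = I ⊗ A_U - B_Vᵀ ⊗ I` with `A_U = Uᴴ A U` and `B_V = Vᵀ B V̄`, and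
`vec (UF VFᵀ)` to `vec (Uᴴ UF VFᵀ V̄)`. Here `V̄ = V.map star` is the entrywise conjugate; for a
real `V` one has `V̄ = V` and `Vᵀ = Vᴴ`. -/
def galerkin {n k m₁ m₂ : ℕ} (A B : Matrix (Fin n) (Fin n) ℂ) (UF VF : Matrix (Fin n) (Fin k) ℂ)
    (U : Matrix (Fin n) (Fin m₁) ℂ) (V : Matrix (Fin n) (Fin m₂) ℂ) : Matrix (Fin n) (Fin n) ℂ :=
  let AU := Uᴴ * A * U
  let BV := Vᵀ * B * V.map star
  let FW := Uᴴ * UF * (VFᵀ * V.map star)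
  let Y := unvec ((sylvesterMatrix AU BV)⁻¹ *ᵥ FW.vec)
  U * Y * Vᵀ

end GalerkinSylvester

end

open GalerkinSylvester

namespace GalerkinSylvester

/-! ### Norms and spectra of Hermitian matrices and their compressions -/

/-! Put `H = Uᴴ A U`, `K = Vᴴ Bᵀ V`, `N = A U - U H` and `N' = Bᵀ V - V K`. The columns of `UF` and
`VF` lie in the Krylov spaces, so the projected equation cancels the diagonal block of the residual.
What remains is `N Y Vᵀ - U Y N'ᵀ`. Since `Uᴴ N = 0` and `Vᴴ N' = 0`, the two terms have orthogonal
ranges and coranges, and the norm of the sum is the maximum of the norms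
(`norm_add_eq_max_of_orthogonal`).

Each term is bounded by `norm_residual_le`; the second is the first for the transposed equation. Let
`q` be the pole polynomial and let `Z` solve the projected equation with `UF` replaced by `q(A)⁻¹
UF`. Then `Y = q(H) Z`, and `N` annihilates the commutation errors, so that `N p(H) Z = N Z p(Kᵀ)`
whenever `deg p ≤ ℓ`. Using this for `q` and for `g`, where `r = g / q`, gives `N Y = N r(H) Y
r(Kᵀ)⁻¹`. Compression keeps the spectra inside the intervals, so the infimum over `r` produces
`theta`. Finally `‖N‖ ≤ 2b` and `2a ‖Y‖ ≤ ‖F‖`, which even gives the factor `b / a` in place of `1 +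
b / a`. -/

theorem norm_le_one_of_conjTranspose_mul_self {n m : ℕ} {U : Matrix (Fin n) (Fin m) ℂ}
    (hU : Uᴴ * U = 1) : ‖U‖ ≤ 1 := by
  have h := l2_opNorm_conjTranspose_mul_self U
  have h1 : ‖(1 : Matrix (Fin m) (Fin m) ℂ)‖ ≤ 1 := by
    -- For `m = 0` the identity is zero and has norm `0`, so only an inequality is available.
    rcases subsingleton_or_nontrivial (Matrix (Fin m) (Fin m) ℂ) with _ | _
    · rw [Subsingleton.elim (1 : Matrix (Fin m) (Fin m) ℂ) 0, norm_zero]; exact zero_le_one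
    · exact CStarRing.norm_one.le
  rw [hU] at h
  nlinarith [norm_nonneg U]

/-- The norm of a rational function of a Hermitian matrix, with the quotient kept in product
form. -/
theorem exists_norm_le_mul_aeval_eq {n : ℕ} {A : Matrix (Fin n) (Fin n) ℂ} (hA : A.IsHermitian)
    {p q : ℂ[X]} {M : ℝ} (hM : 0 ≤ M) (hq : ∀ z ∈ spectrum ℂ A, q.eval z ≠ 0)
    (hpq : ∀ z ∈ spectrum ℂ A, ‖p.eval z‖ ≤ M * ‖q.eval z‖) :
    ∃ T : Matrix (Fin n) (Fin n) ℂ, ‖T‖ ≤ M ∧ T * aeval A q = aeval A p ∧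
      aeval A q * T = aeval A p := by
  have hn : IsStarNormal A := (show IsSelfAdjoint A from hA).isStarNormal
  have hcont : ContinuousOn (fun z => p.eval z / q.eval z) (spectrum ℂ A) :=
    p.continuousOn.div q.continuousOn hq
  refine ⟨cfc (fun z => p.eval z / q.eval z) A, norm_cfc_le hM fun z hz => ?_, ?_, ?_⟩
  · rw [norm_div, div_le_iff₀ (norm_pos_iff.mpr (hq z hz))]
    exact hpq z hz
  · rw [← cfc_polynomial q A, ← cfc_polynomial p A,
      ← cfc_mul (fun z => p.eval z / q.eval z) q.eval A hcont q.continuousOn]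
    exact cfc_congr fun z hz => div_mul_cancel₀ _ (hq z hz)
  · rw [← cfc_polynomial q A, ← cfc_polynomial p A,
      ← cfc_mul q.eval (fun z => p.eval z / q.eval z) A q.continuousOn hcont]
    exact cfc_congr fun z hz => mul_div_cancel₀ _ (hq z hz)

theorem norm_sub_smul_one_le {n : ℕ} {A : Matrix (Fin n) (Fin n) ℂ} (hA : A.IsHermitian)
    {s t : ℝ} (hst : s ≤ t) (h : spectrum ℂ A ⊆ realInterval s t) :
    ‖A - (((s + t) / 2 : ℝ) : ℂ) • (1 : Matrix (Fin n) (Fin n) ℂ)‖ ≤ (t - s) / 2 := by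
  obtain ⟨T, hT, h1, -⟩ := exists_norm_le_mul_aeval_eq hA
    (p := X - C (((s + t) / 2 : ℝ) : ℂ)) (q := 1) (M := (t - s) / 2) (by linarith) (by simp)
    (by
      intro z hz
      obtain ⟨x, ⟨hx1, hx2⟩, rfl⟩ := h hz
      rw [eval_sub, eval_X, eval_C, eval_one, norm_one, mul_one, ← Complex.ofReal_sub,
        Complex.norm_real, Real.norm_eq_abs, abs_le]
      constructor <;> linarith)
  rw [map_one, mul_one] at h1
  rw [h1, map_sub, aeval_X, aeval_C, Algebra.algebraMap_eq_smul_one] at hT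
  exact hT

theorem spectrum_subset_realInterval {n : ℕ} {A : Matrix (Fin n) (Fin n) ℂ} (hA : A.IsHermitian)
    {s t : ℝ}
    (h : ‖A - (((s + t) / 2 : ℝ) : ℂ) • (1 : Matrix (Fin n) (Fin n) ℂ)‖ ≤ (t - s) / 2) :
    spectrum ℂ A ⊆ realInterval s t := by
  intro z hz
  have hne : Nontrivial (Matrix (Fin n) (Fin n) ℂ) := by
    by_contra hn
    rw [not_nontrivial_iff_subsingleton] at hn
    rw [spectrum.of_subsingleton] at hz
    exact hz
  obtain ⟨x, hx⟩ : ∃ x : ℝ, z = x :=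
    ⟨z.re, (show IsSelfAdjoint A from hA).mem_spectrum_eq_re hz⟩
  subst hx
  have hz' : (x : ℂ) - (((s + t) / 2 : ℝ) : ℂ) ∈
      spectrum ℂ (A - algebraMap ℂ (Matrix (Fin n) (Fin n) ℂ) (((s + t) / 2 : ℝ) : ℂ)) := by
    rw [sub_eq_add_neg (x : ℂ), sub_eq_add_neg A, ← map_neg, add_comm A]
    exact spectrum.add_mem_add_iff.mpr hz
  rw [← Algebra.algebraMap_eq_smul_one] at h
  have := (spectrum.norm_le_norm_of_mem hz').trans h
  rw [← Complex.ofReal_sub, Complex.norm_real, Real.norm_eq_abs, abs_le] at this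
  exact ⟨x, ⟨by linarith, by linarith⟩, rfl⟩

/-- For a Hermitian matrix, spectrum in `[s, t]` means distance at most `(t - s) / 2` from the
midpoint multiple of `1`, and compression by an isometry does not increase this distance. -/
theorem spectrum_compression_subset {n m : ℕ} {A : Matrix (Fin n) (Fin n) ℂ} (hA : A.IsHermitian)
    {s t : ℝ} (hst : s ≤ t) (h : spectrum ℂ A ⊆ realInterval s t) {U : Matrix (Fin n) (Fin m) ℂ}
    (hU : Uᴴ * U = 1) : spectrum ℂ (Uᴴ * A * U) ⊆ realInterval s t := by
  refine spectrum_subset_realInterval (isHermitian_conjTranspose_mul_mul U hA) ?_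
  set c : ℂ := (((s + t) / 2 : ℝ) : ℂ)
  have h0 : Uᴴ * A * U - c • (1 : Matrix (Fin m) (Fin m) ℂ) =
      Uᴴ * (A - c • (1 : Matrix (Fin n) (Fin n) ℂ)) * U := by
    rw [Matrix.mul_sub, Matrix.sub_mul, Matrix.mul_smul, Matrix.mul_one, Matrix.smul_mul, hU]
  have hU1 := norm_le_one_of_conjTranspose_mul_self hU
  have hA1 := norm_sub_smul_one_le hA hst h
  rw [h0]
  calc _ ≤ ‖Uᴴ‖ * ‖A - c • (1 : Matrix (Fin n) (Fin n) ℂ)‖ * ‖U‖ :=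
        (l2_opNorm_mul _ _).trans
          (mul_le_mul_of_nonneg_right (l2_opNorm_mul _ _) (norm_nonneg _))
    _ ≤ 1 * ‖A - c • (1 : Matrix (Fin n) (Fin n) ℂ)‖ * 1 := by
        rw [l2_opNorm_conjTranspose]; gcongr
    _ ≤ _ := by rw [one_mul, mul_one]; exact hA1

theorem norm_le_of_spectrum_subset {n : ℕ} {A : Matrix (Fin n) (Fin n) ℂ} (hA : A.IsHermitian)
    {b s t : ℝ} (hb : 0 ≤ b) (hs : -b ≤ s) (ht : t ≤ b) (h : spectrum ℂ A ⊆ realInterval s t) :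
    ‖A‖ ≤ b := by
  obtain ⟨T, hT, h1, -⟩ := exists_norm_le_mul_aeval_eq hA (p := X) (q := 1) hb (by simp)
    (by
      intro z hz
      obtain ⟨x, ⟨hx1, hx2⟩, rfl⟩ := h hz
      rw [eval_X, eval_one, norm_one, mul_one, Complex.norm_real, Real.norm_eq_abs, abs_le]
      constructor <;> linarith)
  rw [map_one, mul_one, aeval_X] at h1
  rwa [h1] at hT

/-! ### The Sylvester operator -/

/-- The Sylvester operator of two Hermitian matrices with spectra in `[s, t]` and `[s', t']`
is bounded below by the distance of the two intervals. -/
theorem mul_norm_le_norm_sylvester {m₁ m₂ : ℕ} {H : Matrix (Fin m₁) (Fin m₁) ℂ}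
    {K : Matrix (Fin m₂) (Fin m₂) ℂ} (hH : H.IsHermitian) (hK : K.IsHermitian) {s t s' t' : ℝ}
    (hst : s ≤ t) (hst' : s' ≤ t') (h : spectrum ℂ H ⊆ realInterval s t)
    (h' : spectrum ℂ K ⊆ realInterval s' t') (Z : Matrix (Fin m₁) (Fin m₂) ℂ) :
    (s - t') * ‖Z‖ ≤ ‖H * Z - Z * K‖ := by
  have hH1 := norm_sub_smul_one_le hH hst h
  have hK1 := norm_sub_smul_one_le hK hst' h'
  set c : ℂ := (((s + t) / 2 : ℝ) : ℂ) with hc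
  set c' : ℂ := (((s' + t') / 2 : ℝ) : ℂ) with hc'
  -- Centring at the midpoints: the distance of the midpoints minus the two radii is the gap `s -
  -- t'`.
  have h1 : (c - c') • Z = (H * Z - Z * K) - (H - c • (1 : Matrix (Fin m₁) (Fin m₁) ℂ)) * Z
      + Z * (K - c' • (1 : Matrix (Fin m₂) (Fin m₂) ℂ)) := by
    rw [Matrix.sub_mul, Matrix.mul_sub, Matrix.smul_mul, Matrix.one_mul, Matrix.mul_smul,
      Matrix.mul_one, sub_smul]
    abel
  have h2 : ‖(c - c') • Z‖ ≤ ‖H * Z - Z * K‖ + (t - s) / 2 * ‖Z‖ + ‖Z‖ * ((t' - s') / 2) := by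
    rw [h1]
    refine (norm_add_le _ _).trans (add_le_add ((norm_sub_le _ _).trans
      (add_le_add le_rfl ((l2_opNorm_mul _ _).trans ?_))) ((l2_opNorm_mul _ _).trans ?_)) <;>
      gcongr
  have h3 : (s + t) / 2 - (s' + t') / 2 ≤ ‖c - c'‖ := by
    rw [hc, hc', ← Complex.ofReal_sub, Complex.norm_real]
    exact Real.le_norm_self _
  rw [norm_smul] at h2
  nlinarith [mul_le_mul_of_nonneg_right h3 (norm_nonneg Z)]

theorem vec_unvec {m₁ m₂ : ℕ} (y : Fin m₂ × Fin m₁ → ℂ) : (unvec y).vec = y := rfl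

theorem sylvesterMatrix_mulVec_vec {m₁ m₂ : ℕ} (H : Matrix (Fin m₁) (Fin m₁) ℂ)
    (K : Matrix (Fin m₂) (Fin m₂) ℂ) (Z : Matrix (Fin m₁) (Fin m₂) ℂ) :
    sylvesterMatrix H K *ᵥ Z.vec = (H * Z - Z * K).vec := by
  rw [sylvesterMatrix, Matrix.sub_mulVec, kronecker_mulVec_vec, kronecker_mulVec_vec, vec_sub,
    transpose_one, transpose_transpose, Matrix.mul_one, Matrix.one_mul]

/-- The lower bound makes the Sylvester operator injective, hence invertible in finite dimension. -/
theorem sylvester_unvec_eq {m₁ m₂ : ℕ} {H : Matrix (Fin m₁) (Fin m₁) ℂ}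
    {K : Matrix (Fin m₂) (Fin m₂) ℂ} {δ : ℝ} (hδ : 0 < δ)
    (h : ∀ Z : Matrix (Fin m₁) (Fin m₂) ℂ, δ * ‖Z‖ ≤ ‖H * Z - Z * K‖)
    (G : Matrix (Fin m₁) (Fin m₂) ℂ) :
    H * unvec ((sylvesterMatrix H K)⁻¹ *ᵥ G.vec) - unvec ((sylvesterMatrix H K)⁻¹ *ᵥ G.vec) * K
      = G := by
  have hu : IsUnit (sylvesterMatrix H K) := by
    rw [← Matrix.mulVec_injective_iff_isUnit]
    refine (injective_iff_map_eq_zero (sylvesterMatrix H K).mulVecLin).mpr fun y hy => ?_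
    rw [mulVecLin_apply, ← vec_unvec y, sylvesterMatrix_mulVec_vec, vec_eq_zero_iff] at hy
    have := h (unvec y)
    rw [hy, norm_zero] at this
    have h0 : unvec y = 0 := norm_le_zero_iff.mp (by nlinarith [norm_nonneg (unvec y)])
    rw [← vec_unvec y, h0, vec_zero]
  rw [← vec_inj, ← sylvesterMatrix_mulVec_vec, vec_unvec, Matrix.mulVec_mulVec,
    Matrix.mul_nonsing_inv _ ((Matrix.isUnit_iff_isUnit_det _).mp hu), Matrix.one_mulVec]

/-- If `N H ^ j W = 0` for all `j < ℓ` and `H Z - Z K = W`, then polynomials of degree at most `ℓ`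
can be moved from one side of `Z` to the other. -/
theorem mul_aeval_mul_eq {m₁ m₂ n ℓ : ℕ} {H : Matrix (Fin m₁) (Fin m₁) ℂ}
    {K : Matrix (Fin m₂) (Fin m₂) ℂ} {Z W : Matrix (Fin m₁) (Fin m₂) ℂ}
    {N : Matrix (Fin n) (Fin m₁) ℂ} (hZ : H * Z - Z * K = W)
    (hN : ∀ j < ℓ, N * (H ^ j * W) = 0) {p : ℂ[X]} (hp : p.natDegree ≤ ℓ) :
    N * (aeval H p * Z) = N * (Z * aeval K p) := by
  have hpow : ∀ j ≤ ℓ, N * (H ^ j * Z) = N * (Z * K ^ j) := by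
    intro j
    induction j with
    | zero => simp
    | succ j ih =>
      intro hj
      have h1 : H * Z = Z * K + W := by rw [← hZ]; abel
      calc N * (H ^ (j + 1) * Z) = N * (H ^ j * Z) * K + N * (H ^ j * W) := by
            rw [pow_succ, Matrix.mul_assoc (H ^ j), h1]
            simp only [Matrix.mul_add, Matrix.mul_assoc]
        _ = N * (Z * K ^ (j + 1)) := by
            rw [ih (by omega), hN j (by omega), add_zero, pow_succ]
            simp only [Matrix.mul_assoc]
  rw [aeval_eq_sum_range' (Nat.lt_succ_of_le hp), aeval_eq_sum_range' (Nat.lt_succ_of_le hp)]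
  simp only [Matrix.sum_mul, Matrix.mul_sum, Matrix.smul_mul, Matrix.mul_smul]
  refine Finset.sum_congr rfl fun j hj => ?_
  rw [hpow j (Nat.lt_succ_iff.mp (Finset.mem_range.mp hj))]

/-! ### The rational functions and `theta` -/

/-- The infimum need not be attained, so a competitor within `ε` of it is used. The minimum enters
through its inverse, which is `0` when the minimum is `∞`. -/
theorem le_theta_mul {ℓ : ℕ} {I₁ I₂ : Set ℂ} {σ : Fin ℓ → OnePoint ℂ} {x K : ℝ} (hK : 0 ≤ K)
    (h : ∀ r ∈ ratClass σ, (⨆ z ∈ I₁, ratAbs r z) ≠ ∞ → (⨅ z ∈ I₂, ratAbs r z) ≠ 0 →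
      x ≤ (⨆ z ∈ I₁, ratAbs r z).toReal * ((⨅ z ∈ I₂, ratAbs r z)⁻¹).toReal * K) :
    x ≤ theta I₁ I₂ σ * K := by
  have hfin : thetaENN I₁ I₂ σ ≠ ∞ :=
    ((thetaENN_le_one I₁ I₂ σ).trans_lt ENNReal.one_lt_top).ne
  have key : ∀ ε : ℝ, 0 < ε → x ≤ (theta I₁ I₂ σ + ε) * K := by
    intro ε hε
    have hlt : thetaENN I₁ I₂ σ < thetaENN I₁ I₂ σ + ENNReal.ofReal ε :=
      ENNReal.lt_add_right hfin (by simpa using hε)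
    obtain ⟨r, hlt⟩ := iInf_lt_iff.mp hlt
    obtain ⟨⟨hr, h1, h2⟩, hlt⟩ := iInf_lt_iff.mp hlt
    refine (h r hr h1 h2).trans (mul_le_mul_of_nonneg_right ?_ hK)
    rw [← ENNReal.toReal_mul, ← div_eq_mul_inv]
    refine (ENNReal.toReal_mono (by finiteness) hlt.le).trans ?_
    change (thetaENN I₁ I₂ σ + ENNReal.ofReal ε).toReal ≤ _
    rw [ENNReal.toReal_add hfin (by finiteness), ENNReal.toReal_ofReal hε.le, theta]
  rcases hK.eq_or_lt with rfl | hK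
  · simpa using key 1 one_pos
  · refine le_of_forall_pos_le_add fun ε hε => ?_
    have := key (ε / K) (by positivity)
    rwa [add_mul, div_mul_cancel₀ _ hK.ne'] at this

theorem theta_nonneg {ℓ : ℕ} (I₁ I₂ : Set ℂ) (σ : Fin ℓ → OnePoint ℂ) : 0 ≤ theta I₁ I₂ σ :=
  ENNReal.toReal_nonneg

theorem num_denom_of_mem_ratClass {ℓ : ℕ} {σ : Fin ℓ → OnePoint ℂ} {r : ℂ⟮X⟯}
    (hr : r ∈ ratClass σ) :
    ∃ d : ℂ[X], polePoly σ = r.denom * d ∧ (r.num * d).natDegree ≤ ℓ := by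
  obtain ⟨g, hg, hrg⟩ := hr
  have hinj := IsFractionRing.injective ℂ[X] ℂ⟮X⟯
  have h0 : algebraMap ℂ[X] ℂ⟮X⟯ r.num / algebraMap ℂ[X] ℂ⟮X⟯ r.denom =
      algebraMap ℂ[X] ℂ⟮X⟯ g / algebraMap ℂ[X] ℂ⟮X⟯ (polePoly σ) :=
    (RatFunc.num_div_denom r).trans hrg
  rw [div_eq_div_iff ((map_ne_zero_iff _ hinj).mpr (RatFunc.denom_ne_zero r))
    ((map_ne_zero_iff _ hinj).mpr (polePoly_ne_zero σ)), ← map_mul, ← map_mul] at h0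
  have h1 := hinj h0
  -- `d` is the factor cancelled between `g` and the pole polynomial.
  obtain ⟨d, hd⟩ : r.denom ∣ polePoly σ :=
    (RatFunc.isCoprime_num_denom r).symm.dvd_of_dvd_mul_left (h1 ▸ dvd_mul_left _ _)
  refine ⟨d, hd, ?_⟩
  have h2 : r.num * d = g := by
    apply mul_right_cancel₀ (RatFunc.denom_ne_zero r)
    rw [← h1, hd]; ring
  rwa [h2]

theorem eval_denom_ne_zero_of_iSup_ne_top {r : ℂ⟮X⟯} {I : Set ℂ}
    (h : (⨆ z ∈ I, ratAbs r z) ≠ ∞) {z : ℂ} (hz : z ∈ I) :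
    r.denom.eval z ≠ 0 ∧ ‖r.num.eval z‖ ≤ (⨆ z ∈ I, ratAbs r z).toReal * ‖r.denom.eval z‖ := by
  have hle : ratAbs r z ≤ ⨆ z ∈ I, ratAbs r z := le_iSup₂ (f := fun z _ => ratAbs r z) z hz
  have hd : r.denom.eval z ≠ 0 := by
    -- By coprimality the numerator cannot vanish too, so `r` would have a pole in `I`.
    intro hd
    have hn : r.num.eval z ≠ 0 := by
      intro hn
      obtain ⟨u, v, huv⟩ := RatFunc.isCoprime_num_denom r
      simpa [hd, hn] using congrArg (eval z) huv
    refine h (top_le_iff.mp (le_trans (le_of_eq ?_) hle))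
    rw [ratAbs, hd, enorm_zero, ENNReal.div_zero (by simpa using hn)]
  refine ⟨hd, ?_⟩
  rw [ratAbs, ENNReal.div_le_iff (by simpa using hd) (by simp)] at hle
  have := ENNReal.toReal_mono (by finiteness) hle
  rwa [ENNReal.toReal_mul, toReal_enorm, toReal_enorm] at this

theorem eval_num_ne_zero_of_iInf_ne_zero {r : ℂ⟮X⟯} {I : Set ℂ}
    (h : (⨅ z ∈ I, ratAbs r z) ≠ 0) {z : ℂ} (hz : z ∈ I) :
    r.num.eval z ≠ 0 ∧
      ‖r.denom.eval z‖ ≤ ((⨅ z ∈ I, ratAbs r z)⁻¹).toReal * ‖r.num.eval z‖ := by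
  have hle : (⨅ z ∈ I, ratAbs r z) ≤ ratAbs r z := iInf₂_le (f := fun z _ => ratAbs r z) z hz
  refine ⟨fun hn => h (le_zero_iff.mp (by simpa [ratAbs, hn] using hle)), ?_⟩
  have h1 : ‖r.denom.eval z‖ₑ ≤ ‖r.num.eval z‖ₑ / (⨅ z ∈ I, ratAbs r z) := by
    rw [ENNReal.le_div_iff_mul_le (Or.inl h) (Or.inr (by simp))]
    exact (mul_le_mul_right hle _).trans ENNReal.mul_div_le
  have := ENNReal.toReal_mono (ENNReal.div_ne_top (by simp) h) h1
  rwa [div_eq_mul_inv, ENNReal.toReal_mul, toReal_enorm, toReal_enorm, mul_comm] at this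

/-! ### Rational Krylov subspaces -/

theorem isUnit_aeval_polePoly {n ℓ : ℕ} {A : Matrix (Fin n) (Fin n) ℂ} {σ : Fin ℓ → OnePoint ℂ}
    (h : PolesAdmissible A σ) : IsUnit (aeval A (polePoly σ)) := by
  have key : ∀ s : Finset (Fin ℓ),
      IsUnit (aeval A (∏ j ∈ s, (σ j).elim (1 : ℂ[X]) (fun s => X - C s))) := by
    intro s
    induction s using Finset.induction_on with
    | empty => simp
    | insert j s hj ih =>
      rw [Finset.prod_insert hj, map_mul]
      refine IsUnit.mul ?_ ih
      have hj' := h j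
      generalize σ j = x at hj' ⊢
      induction x using OnePoint.rec with
      | infty => simp
      | coe z =>
        have h1 := spectrum.notMem_iff.mp (hj' z rfl)
        have h2 : aeval A ((z : OnePoint ℂ).elim (1 : ℂ[X]) (fun s => X - C s)) =
            -(algebraMap ℂ _ z - A) := by
          simp
        rw [h2]
        exact h1.neg
  exact key Finset.univ

theorem mul_conjTranspose_mul_eq_of_col_mem {n m k : ℕ} {U : Matrix (Fin n) (Fin m) ℂ}
    {S : Submodule ℂ (Fin n → ℂ)} (hU : IsOrthonormalBasisOf U S) {w : Matrix (Fin n) (Fin k) ℂ}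
    (hw : ∀ c, w.col c ∈ S) : U * (Uᴴ * w) = w := by
  refine Matrix.ext_col fun c => ?_
  have hc := hw c
  rw [← hU.2, ← Matrix.range_mulVecLin] at hc
  obtain ⟨y, hy⟩ := hc
  have h1 : (U * (Uᴴ * w)).col c = U *ᵥ (Uᴴ *ᵥ w.col c) := by
    rw [← Matrix.mul_assoc, Matrix.mulVec_mulVec]; rfl
  rw [h1, ← hy, mulVecLin_apply, Matrix.mulVec_mulVec y Uᴴ U, hU.1, Matrix.one_mulVec]

section

variable {n k m ℓ : ℕ} {A : Matrix (Fin n) (Fin n) ℂ} {v : Matrix (Fin n) (Fin k) ℂ}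
  {σ : Fin ℓ → OnePoint ℂ} {U : Matrix (Fin n) (Fin m) ℂ}

theorem mul_conjTranspose_mul_pow_mul (hU : IsOrthonormalBasisOf U (rationalKrylov A v σ))
    (hσ : PolesAdmissible A σ) {j : ℕ} (hj : j ≤ ℓ) :
    U * (Uᴴ * (A ^ j * ((aeval A (polePoly σ))⁻¹ * v))) =
      A ^ j * ((aeval A (polePoly σ))⁻¹ * v) := by
  have hcomm : A ^ j * (aeval A (polePoly σ))⁻¹ = (aeval A (polePoly σ))⁻¹ * A ^ j := by
    have hu := (Matrix.isUnit_iff_isUnit_det _).mp (isUnit_aeval_polePoly hσ)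
    have h1 : A ^ j * aeval A (polePoly σ) = aeval A (polePoly σ) * A ^ j := by
      conv_lhs => rw [← aeval_X (R := ℂ) A, aeval_X, ← aeval_X_pow (R := ℂ) A, ← map_mul, mul_comm,
        map_mul]
      rw [aeval_X_pow]
    calc A ^ j * (aeval A (polePoly σ))⁻¹
        = (aeval A (polePoly σ))⁻¹ * (aeval A (polePoly σ) * A ^ j) *
            (aeval A (polePoly σ))⁻¹ := by
          rw [← Matrix.mul_assoc, Matrix.nonsing_inv_mul _ hu, Matrix.one_mul]
      _ = _ := by
          rw [← h1, Matrix.mul_assoc, Matrix.mul_assoc, Matrix.mul_nonsing_inv _ hu,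
            Matrix.mul_one]
  refine mul_conjTranspose_mul_eq_of_col_mem hU fun c => Submodule.subset_span ⟨j, hj, c, ?_⟩
  rw [← Matrix.mul_assoc, hcomm]

/-- Since `deg q ≤ ℓ`, `v = q(A) (q(A)⁻¹ v)` is a combination of the generating blocks of the
subspace. -/
theorem mul_conjTranspose_mul_self_of_rationalKrylov
    (hU : IsOrthonormalBasisOf U (rationalKrylov A v σ)) (hσ : PolesAdmissible A σ) :
    U * (Uᴴ * v) = v := by
  have hu := (Matrix.isUnit_iff_isUnit_det _).mp (isUnit_aeval_polePoly hσ)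
  have h1 : v = aeval A (polePoly σ) * ((aeval A (polePoly σ))⁻¹ * v) := by
    rw [← Matrix.mul_assoc, Matrix.mul_nonsing_inv _ hu, Matrix.one_mul]
  set w := (aeval A (polePoly σ))⁻¹ * v with hw
  rw [h1, aeval_eq_sum_range' (Nat.lt_succ_of_le (natDegree_polePoly_le σ))]
  simp only [Matrix.sum_mul, Matrix.mul_sum, Matrix.smul_mul, Matrix.mul_smul]
  refine Finset.sum_congr rfl fun j hj => ?_
  rw [hw, mul_conjTranspose_mul_pow_mul hU hσ (Nat.lt_succ_iff.mp (Finset.mem_range.mp hj))]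

theorem compression_pow_mul (hU : IsOrthonormalBasisOf U (rationalKrylov A v σ))
    (hσ : PolesAdmissible A σ) {j : ℕ} (hj : j ≤ ℓ) :
    (Uᴴ * A * U) ^ j * (Uᴴ * ((aeval A (polePoly σ))⁻¹ * v)) =
      Uᴴ * (A ^ j * ((aeval A (polePoly σ))⁻¹ * v)) := by
  induction j with
  | zero => simp
  | succ j ih =>
    rw [pow_succ', Matrix.mul_assoc (Uᴴ * A * U), ih (by omega), Matrix.mul_assoc (Uᴴ * A),
      mul_conjTranspose_mul_pow_mul hU hσ (by omega), pow_succ' A]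
    simp only [Matrix.mul_assoc]

/-- Exactness of the compression on the Krylov space, in product form because a pole may be an
eigenvalue of `Uᴴ A U`, making `q(Uᴴ A U)` singular. -/
theorem aeval_compression_mul (hU : IsOrthonormalBasisOf U (rationalKrylov A v σ))
    (hσ : PolesAdmissible A σ) :
    aeval (Uᴴ * A * U) (polePoly σ) * (Uᴴ * ((aeval A (polePoly σ))⁻¹ * v)) = Uᴴ * v := by
  have hu := (Matrix.isUnit_iff_isUnit_det _).mp (isUnit_aeval_polePoly hσ)
  have h1 : v = aeval A (polePoly σ) * ((aeval A (polePoly σ))⁻¹ * v) := by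
    rw [← Matrix.mul_assoc, Matrix.mul_nonsing_inv _ hu, Matrix.one_mul]
  set w := (aeval A (polePoly σ))⁻¹ * v with hw
  rw [h1, aeval_eq_sum_range' (x := A) (Nat.lt_succ_of_le (natDegree_polePoly_le σ)),
    aeval_eq_sum_range' (x := Uᴴ * A * U) (Nat.lt_succ_of_le (natDegree_polePoly_le σ))]
  simp only [Matrix.sum_mul, Matrix.mul_sum, Matrix.smul_mul, Matrix.mul_smul]
  refine Finset.sum_congr rfl fun j hj => ?_
  rw [hw, compression_pow_mul hU hσ (Nat.lt_succ_iff.mp (Finset.mem_range.mp hj))]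

/-- The part of the residual of the projected equation that is orthogonal to the rational Krylov
subspace. -/
theorem norm_residual_le {m' : ℕ} {s t s' t' δ : ℝ} (hA : A.IsHermitian) (hst : s ≤ t)
    (hspec : spectrum ℂ A ⊆ realInterval s t) {K : Matrix (Fin m') (Fin m') ℂ}
    (hK : K.IsHermitian) (hspecK : spectrum ℂ K ⊆ realInterval s' t') (hδ : 0 < δ)
    (hsep : ∀ Z : Matrix (Fin m) (Fin m') ℂ, δ * ‖Z‖ ≤ ‖Uᴴ * A * U * Z - Z * K‖)
    (hU : IsOrthonormalBasisOf U (rationalKrylov A v σ)) (hσ : PolesAdmissible A σ)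
    {E : Matrix (Fin k) (Fin m') ℂ} {Y : Matrix (Fin m) (Fin m') ℂ}
    (hY : Uᴴ * A * U * Y - Y * K = Uᴴ * v * E) :
    ‖(A * U - U * (Uᴴ * A * U)) * Y‖ ≤
      theta (realInterval s t) (realInterval s' t') σ *
        (‖A * U - U * (Uᴴ * A * U)‖ * ‖Y‖) := by
  set H := Uᴴ * A * U with hHdef
  set N := A * U - U * H with hNdef
  set w := (aeval A (polePoly σ))⁻¹ * v with hw
  set W := Uᴴ * w * E with hW
  obtain ⟨Z, hZ⟩ : ∃ Z, H * Z - Z * K = W := ⟨_, sylvester_unvec_eq hδ hsep W⟩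
  have hH : H.IsHermitian := isHermitian_conjTranspose_mul_mul U hA
  have hspecH := spectrum_compression_subset hA hst hspec hU.1
  -- `U Uᴴ` fixes both `A ^ j w` and `A ^ (j + 1) w`; the second needs `j + 1 ≤ ℓ`.
  have hN : ∀ j < ℓ, N * (H ^ j * W) = 0 := by
    intro j hj
    have h1 : U * (Uᴴ * (A * (A ^ j * w))) = A * (A ^ j * w) := by
      have := mul_conjTranspose_mul_pow_mul hU hσ (j := j + 1) hj
      rwa [pow_succ', Matrix.mul_assoc A] at this
    have h2 : N * (Uᴴ * (A ^ j * w)) = 0 := by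
      have h3 := mul_conjTranspose_mul_pow_mul hU hσ hj.le
      rw [← hw] at h3
      rw [hNdef, hHdef, Matrix.sub_mul]
      simp only [Matrix.mul_assoc]
      rw [h3, h1, sub_self]
    rw [hW, ← Matrix.mul_assoc (H ^ j), compression_pow_mul hU hσ hj.le, ← hw,
      ← Matrix.mul_assoc N, h2, Matrix.zero_mul]
  -- Both sides solve the same Sylvester equation, and `hsep` gives uniqueness.
  have hYZ : Y = aeval H (polePoly σ) * Z := by
    have hcomm : H * aeval H (polePoly σ) = aeval H (polePoly σ) * H := by
      have := congrArg (aeval H) (mul_comm X (polePoly σ))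
      rwa [map_mul, map_mul, aeval_X] at this
    have h1 : H * (aeval H (polePoly σ) * Z) - aeval H (polePoly σ) * Z * K = Uᴴ * v * E := by
      rw [← aeval_compression_mul hU hσ, ← hw, ← hHdef, Matrix.mul_assoc (aeval H _) (Uᴴ * w),
        ← hW, ← hZ, Matrix.mul_sub, ← Matrix.mul_assoc H, hcomm]
      simp only [Matrix.mul_assoc]
    have h2 := hsep (Y - aeval H (polePoly σ) * Z)
    have h3 : H * (Y - aeval H (polePoly σ) * Z) - (Y - aeval H (polePoly σ) * Z) * K = 0 := by
      rw [Matrix.mul_sub, Matrix.sub_mul, sub_sub_sub_comm, hY, h1, sub_self]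
    rw [h3, norm_zero] at h2
    exact sub_eq_zero.mp (norm_le_zero_iff.mp
      (by nlinarith [norm_nonneg (Y - aeval H (polePoly σ) * Z)]))
  refine le_theta_mul (by positivity) fun r hr hr1 hr2 => ?_
  obtain ⟨d, hqd, hgd⟩ := num_denom_of_mem_ratClass hr
  obtain ⟨T, hT, hT1, -⟩ := exists_norm_le_mul_aeval_eq hH ENNReal.toReal_nonneg
    (fun z hz => (eval_denom_ne_zero_of_iSup_ne_top hr1 (hspecH hz)).1)
    (fun z hz => (eval_denom_ne_zero_of_iSup_ne_top hr1 (hspecH hz)).2)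
  obtain ⟨T', hT', -, hT1'⟩ := exists_norm_le_mul_aeval_eq hK ENNReal.toReal_nonneg
    (fun z hz => (eval_num_ne_zero_of_iInf_ne_zero hr2 (hspecK hz)).1)
    (fun z hz => (eval_num_ne_zero_of_iInf_ne_zero hr2 (hspecK hz)).2)
  -- `T` is `r(H)` and `T'` is `r(K)⁻¹`; the cancelled factor `d` is restored on both sides, so it
  -- is never inverted.
  have hTg : T * aeval H (polePoly σ) = aeval H (r.num * d) := by
    rw [hqd, map_mul, map_mul, ← hT1, Matrix.mul_assoc]
  have hTg' : aeval K (polePoly σ) = aeval K (r.num * d) * T' := by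
    rw [hqd, mul_comm r.denom, mul_comm r.num, map_mul, map_mul, ← hT1', Matrix.mul_assoc]
  have key : N * Y = N * (T * Y) * T' := by
    calc N * Y = N * (Z * aeval K (polePoly σ)) := by
          rw [hYZ, mul_aeval_mul_eq hZ hN (natDegree_polePoly_le σ)]
      _ = N * (Z * aeval K (r.num * d)) * T' := by
          rw [hTg']; simp only [Matrix.mul_assoc]
      _ = N * (T * Y) * T' := by
          rw [← mul_aeval_mul_eq hZ hN hgd, ← hTg, hYZ, Matrix.mul_assoc T]
  rw [key]
  calc ‖N * (T * Y) * T'‖ ≤ ‖N‖ * (‖T‖ * ‖Y‖) * ‖T'‖ :=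
        (l2_opNorm_mul _ _).trans (mul_le_mul_of_nonneg_right ((l2_opNorm_mul _ _).trans
          (mul_le_mul_of_nonneg_left (l2_opNorm_mul _ _) (norm_nonneg _))) (norm_nonneg _))
    _ ≤ ‖N‖ * ((⨆ z ∈ realInterval s t, ratAbs r z).toReal * ‖Y‖) *
          ((⨅ z ∈ realInterval s' t', ratAbs r z)⁻¹).toReal := by gcongr
    _ = _ := by ring

end

/-! ### The spectral norm of orthogonal sums -/

/-- By the C*-identity it suffices to treat `Pᴴ P + Qᴴ Q`, a sum of self-adjoint elements with
product zero. -/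
theorem norm_add_eq_max_of_orthogonal {n : ℕ} {P Q : Matrix (Fin n) (Fin n) ℂ}
    (h₁ : Pᴴ * Q = 0) (h₂ : P * Qᴴ = 0) : ‖P + Q‖ = max ‖P‖ ‖Q‖ := by
  have h₁' : Qᴴ * P = 0 := by
    rw [← conjTranspose_conjTranspose P, ← conjTranspose_mul, h₁, conjTranspose_zero]
  have h3 : (P + Q)ᴴ * (P + Q) = Pᴴ * P + Qᴴ * Q := by
    rw [conjTranspose_add, Matrix.add_mul, Matrix.mul_add, Matrix.mul_add, h₁, h₁', add_zero,
      zero_add]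
  have h4 : (Pᴴ * P) * (Qᴴ * Q) = 0 := by
    rw [Matrix.mul_assoc, ← Matrix.mul_assoc P, h₂, Matrix.zero_mul, Matrix.mul_zero]
  have h5 := IsSelfAdjoint.norm_add_eq_max
    (isHermitian_conjTranspose_mul_self P) (isHermitian_conjTranspose_mul_self Q) h4
  rw [← h3, l2_opNorm_conjTranspose_mul_self, l2_opNorm_conjTranspose_mul_self,
    l2_opNorm_conjTranspose_mul_self] at h5
  rcases le_total ‖P‖ ‖Q‖ with h | h
  · rw [max_eq_right h]
    rw [max_eq_right (by gcongr)] at h5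
    exact (mul_self_inj (norm_nonneg _) (norm_nonneg _)).mp h5
  · rw [max_eq_left h]
    rw [max_eq_left (by gcongr)] at h5
    exact (mul_self_inj (norm_nonneg _) (norm_nonneg _)).mp h5

theorem l2_opNorm_map_star_le {m n : ℕ} (P : Matrix (Fin m) (Fin n) ℂ) :
    ‖P.map star‖ ≤ ‖P‖ := by
  have hstar : ∀ {k : ℕ} (x : Fin k → ℂ), ‖WithLp.toLp 2 (star x)‖ = ‖WithLp.toLp 2 x‖ := by
    intro k x
    simp [EuclideanSpace.norm_eq]
  rw [l2_opNorm_def]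
  refine ContinuousLinearMap.opNorm_le_bound _ (norm_nonneg _) fun x => ?_
  have h1 : (P.map star) *ᵥ x.ofLp = star (P *ᵥ star x.ofLp) := by
    ext i
    simp [Matrix.mulVec, dotProduct]
  have h2 := l2_opNorm_mulVec P (WithLp.toLp 2 (star x.ofLp))
  rw [hstar] at h2
  change ‖WithLp.toLp 2 ((P.map star) *ᵥ x.ofLp)‖ ≤ _
  rw [h1, hstar]
  exact h2

theorem l2_opNorm_transpose {m n : ℕ} (P : Matrix (Fin m) (Fin n) ℂ) : ‖Pᵀ‖ = ‖P‖ := by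
  have key : ∀ {m n : ℕ} (P : Matrix (Fin m) (Fin n) ℂ), ‖Pᵀ‖ ≤ ‖P‖ := by
    intro m n P
    have h : Pᵀ = (P.map star)ᴴ := by
      ext i j
      simp
    rw [h, l2_opNorm_conjTranspose]
    exact l2_opNorm_map_star_le P
  exact le_antisymm (key P) (by simpa using key Pᵀ)

theorem spectrum_transpose {n : ℕ} (M : Matrix (Fin n) (Fin n) ℂ) :
    spectrum ℂ Mᵀ = spectrum ℂ M := by
  ext z
  have h : algebraMap ℂ (Matrix (Fin n) (Fin n) ℂ) z - Mᵀ =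
      (algebraMap ℂ (Matrix (Fin n) (Fin n) ℂ) z - M)ᵀ := by
    rw [transpose_sub, Algebra.algebraMap_eq_smul_one, transpose_smul, transpose_one]
  rw [spectrum.mem_iff, spectrum.mem_iff, h, Matrix.isUnit_transpose]

theorem norm_mul_sub_le {n m : ℕ} {A : Matrix (Fin n) (Fin n) ℂ} {U : Matrix (Fin n) (Fin m) ℂ}
    (hU : Uᴴ * U = 1) : ‖A * U - U * (Uᴴ * A * U)‖ ≤ 2 * ‖A‖ := by
  have hU1 := norm_le_one_of_conjTranspose_mul_self hU
  have hAU : ‖A * U‖ ≤ ‖A‖ := (l2_opNorm_mul _ _).trans (mul_le_of_le_one_right (norm_nonneg _) hU1)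
  refine (norm_sub_le _ _).trans ?_
  rw [Matrix.mul_assoc Uᴴ]
  have h2 : ‖Uᴴ * (A * U)‖ ≤ ‖A * U‖ := by
    refine (l2_opNorm_mul _ _).trans (mul_le_of_le_one_left (norm_nonneg _) ?_)
    rwa [l2_opNorm_conjTranspose]
  have h3 : ‖U * (Uᴴ * (A * U))‖ ≤ ‖Uᴴ * (A * U)‖ :=
    (l2_opNorm_mul _ _).trans (mul_le_of_le_one_left (norm_nonneg _) hU1)
  linarith

end GalerkinSylvester

/-! ### The residual bound -/

theorem mainTheorem10 {n k m₁ m₂ ℓ : ℕ} (a b : ℝ) (ha : 0 < a) (hab : a ≤ b)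
    (A B : Matrix (Fin n) (Fin n) ℂ) (hA : A.PosDef) (hB : (-B).PosDef)
    -- intervals `I_A = [sA, tA] ⊆ [a, b]` and `I_B = [sB, tB] ⊆ [-b, -a]` containing the spectra
    (sA tA sB tB : ℝ) (hsA : a ≤ sA) (htA : tA ≤ b) (hsB : -b ≤ sB) (htB : tB ≤ -a)
    (hspecA : spectrum ℂ A ⊆ realInterval sA tA) (hspecB : spectrum ℂ B ⊆ realInterval sB tB)
    -- the right-hand side `F = UF VFᵀ`
    (UF VF : Matrix (Fin n) (Fin k) ℂ) (F : Matrix (Fin n) (Fin n) ℂ) (hF : F = UF * VFᵀ)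
    -- the poles
    (Ψ Ξ : Fin ℓ → OnePoint ℂ) (hΨ : PolesAdmissible A Ψ) (hΞ : PolesAdmissible Bᵀ Ξ)
    -- orthonormal bases of the two rational Krylov subspaces
    (U : Matrix (Fin n) (Fin m₁) ℂ) (hU : IsOrthonormalBasisOf U (rationalKrylov A UF Ψ))
    (V : Matrix (Fin n) (Fin m₂) ℂ) (hV : IsOrthonormalBasisOf V (rationalKrylov Bᵀ VF Ξ)) :
    ‖A * galerkin A B UF VF U V - galerkin A B UF VF U V * B - F‖ ≤
      (1 + b / a) *
        max (theta (realInterval sA tA) (realInterval sB tB) Ψ)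
          (theta (realInterval sB tB) (realInterval sA tA) Ξ) * ‖F‖ := by
  have hb : 0 < b := ha.trans_le hab
  -- For `n = 0` the spectra are empty and do not force `sA ≤ tA` and `sB ≤ tB`.
  rcases Nat.eq_zero_or_pos n with rfl | hn
  · rw [Subsingleton.elim (A * galerkin A B UF VF U V - galerkin A B UF VF U V * B - F) 0,
      norm_zero]
    have := theta_nonneg (realInterval sA tA) (realInterval sB tB) Ψ
    positivity
  have : NeZero n := ⟨hn.ne'⟩
  have hB' : B.IsHermitian := by simpa using hB.1.neg
  have hBt : Bᵀ.IsHermitian := hB'.transpose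
  have hspecBt : spectrum ℂ Bᵀ ⊆ realInterval sB tB := by rwa [spectrum_transpose]
  have hstA : sA ≤ tA := by
    obtain ⟨z, hz⟩ := spectrum.nonempty_of_isAlgClosed_of_finiteDimensional ℂ A
    obtain ⟨x, hx, -⟩ := hspecA hz
    exact hx.1.trans hx.2
  have hstB : sB ≤ tB := by
    obtain ⟨z, hz⟩ := spectrum.nonempty_of_isAlgClosed_of_finiteDimensional ℂ B
    obtain ⟨x, hx, -⟩ := hspecB hz
    exact hx.1.trans hx.2
  have hU1 := norm_le_one_of_conjTranspose_mul_self hU.1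
  have hV1 := norm_le_one_of_conjTranspose_mul_self hV.1
  have hnA : ‖A‖ ≤ b := norm_le_of_spectrum_subset hA.1 hb.le (by linarith) htA hspecA
  have hnB : ‖Bᵀ‖ ≤ b := norm_le_of_spectrum_subset hBt hb.le hsB (by linarith) hspecBt
  -- the projected equation
  set H := Uᴴ * A * U with hH
  set K := Vᴴ * Bᵀ * V with hK
  have hstar : V.map star = Vᴴᵀ := by ext i j; simp
  have hKt : Vᵀ * B * V.map star = Kᵀ := by
    rw [hK, hstar, transpose_mul, transpose_mul, transpose_transpose, Matrix.mul_assoc]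
  have hHh : H.IsHermitian := isHermitian_conjTranspose_mul_mul U hA.1
  have hKh : K.IsHermitian := isHermitian_conjTranspose_mul_mul V hBt
  have hspecH : spectrum ℂ H ⊆ realInterval sA tA :=
    spectrum_compression_subset hA.1 hstA hspecA hU.1
  have hspecK : spectrum ℂ K ⊆ realInterval sB tB :=
    spectrum_compression_subset hBt hstB hspecBt hV.1
  have hspecHt : spectrum ℂ Hᵀ ⊆ realInterval sA tA := by rwa [spectrum_transpose]
  have hspecKt : spectrum ℂ Kᵀ ⊆ realInterval sB tB := by rwa [spectrum_transpose]
  -- The gap is `sA - tB ≥ a - (-a) = 2 * a`.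
  have hsep : ∀ Z : Matrix (Fin m₁) (Fin m₂) ℂ, 2 * a * ‖Z‖ ≤ ‖H * Z - Z * Kᵀ‖ := fun Z =>
    (mul_le_mul_of_nonneg_right (by linarith) (norm_nonneg Z)).trans
      (mul_norm_le_norm_sylvester hHh hKh.transpose hstA hstB hspecH hspecKt Z)
  have hsep' : ∀ Z : Matrix (Fin m₂) (Fin m₁) ℂ, 2 * a * ‖Z‖ ≤ ‖K * Z - Z * Hᵀ‖ := by
    intro Z
    have h := hsep Zᵀ
    rw [l2_opNorm_transpose, ← l2_opNorm_transpose (H * Zᵀ - Zᵀ * Kᵀ), transpose_sub,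
      transpose_mul H, transpose_mul Zᵀ, transpose_transpose, transpose_transpose, norm_sub_rev] at h
    exact h
  set G := Uᴴ * UF * (VFᵀ * V.map star) with hG
  set Y := unvec ((sylvesterMatrix H Kᵀ)⁻¹ *ᵥ G.vec)
  have hX : galerkin A B UF VF U V = U * Y * Vᵀ := by
    simp only [galerkin]
    rw [hKt]
  have hY : H * Y - Y * Kᵀ = G := sylvester_unvec_eq (by positivity) hsep G
  -- Transposing exchanges the two coefficients and reverses the sign, whence `-Yᵀ`.
  have hY' : K * (-Yᵀ) - (-Yᵀ) * Hᵀ = Vᴴ * VF * (UFᵀ * Uᴴᵀ) := by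
    have h := congrArg Matrix.transpose hY
    rw [transpose_sub, transpose_mul H, transpose_mul Y, transpose_transpose, hG,
      transpose_mul (Uᴴ * UF), transpose_mul VFᵀ, transpose_mul Uᴴ, transpose_transpose, hstar, transpose_transpose] at h
    rw [← h, Matrix.mul_neg, Matrix.neg_mul]
    abel
  have hUF := mul_conjTranspose_mul_self_of_rationalKrylov hU hΨ
  have hVF := mul_conjTranspose_mul_self_of_rationalKrylov hV hΞ
  have hGF : G = Uᴴ * F * V.map star := by
    rw [hG, hF]; simp only [Matrix.mul_assoc]
  have hFG : U * G * Vᵀ = F := by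
    have h1 : VFᵀ * (V.map star * Vᵀ) = VFᵀ := by
      have h := congrArg Matrix.transpose hVF
      rwa [transpose_mul, transpose_mul, ← hstar, Matrix.mul_assoc] at h
    calc U * G * Vᵀ = U * (Uᴴ * UF) * (VFᵀ * (V.map star * Vᵀ)) := by
          rw [hG]; simp only [Matrix.mul_assoc]
      _ = F := by rw [hUF, h1, hF]
  have hnG : ‖G‖ ≤ ‖F‖ := by
    rw [hGF]
    calc ‖Uᴴ * F * V.map star‖ ≤ ‖Uᴴ‖ * ‖F‖ * ‖V.map star‖ :=
          (l2_opNorm_mul _ _).trans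
            (mul_le_mul_of_nonneg_right (l2_opNorm_mul _ _) (norm_nonneg _))
      _ ≤ 1 * ‖F‖ * 1 := by
          rw [hstar, l2_opNorm_transpose, l2_opNorm_conjTranspose, l2_opNorm_conjTranspose]
          gcongr
      _ = ‖F‖ := by ring
  have hnY : 2 * a * ‖Y‖ ≤ ‖F‖ := (hsep Y).trans (by rw [hY]; exact hnG)
  -- the two off-diagonal blocks of the residual
  set N := A * U - U * H with hN
  set N' := Bᵀ * V - V * K with hN'
  have hUN : Uᴴ * N = 0 := by
    rw [hN, Matrix.mul_sub, ← Matrix.mul_assoc, ← Matrix.mul_assoc, hU.1, Matrix.one_mul, hH,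
      sub_self]
  have hVN : Vᴴ * N' = 0 := by
    rw [hN', Matrix.mul_sub, ← Matrix.mul_assoc, ← Matrix.mul_assoc, hV.1, Matrix.one_mul, hK,
      sub_self]
  -- `2b` bounds `‖N‖` and `‖N'‖`, and `2a ‖Y‖ ≤ ‖F‖` turns it into `b / a`.
  have hblock : ∀ {x θ : ℝ}, 0 ≤ θ → x ≤ θ * (2 * b * ‖Y‖) → x ≤ (1 + b / a) * θ * ‖F‖ := by
    intro x θ hθ hx
    have h1 : 2 * b * ‖Y‖ ≤ b / a * ‖F‖ := by
      calc 2 * b * ‖Y‖ = b / a * (2 * a * ‖Y‖) := by field_simp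
        _ ≤ _ := by gcongr
    have h2 : 2 * b * ‖Y‖ ≤ (1 + b / a) * ‖F‖ := by nlinarith [norm_nonneg F]
    nlinarith [mul_le_mul_of_nonneg_left h2 hθ]
  have hR1 : ‖N * Y‖ ≤ theta (realInterval sA tA) (realInterval sB tB) Ψ * (2 * b * ‖Y‖) := by
    refine (norm_residual_le hA.1 hstA hspecA hKh.transpose hspecKt (by positivity) hsep hU hΨ
      (by rw [← hG]; exact hY)).trans (mul_le_mul_of_nonneg_left ?_ (theta_nonneg _ _ _))
    exact mul_le_mul_of_nonneg_right ((norm_mul_sub_le hU.1).trans (by linarith)) (norm_nonneg _)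
  have hR2 : ‖N' * -Yᵀ‖ ≤
      theta (realInterval sB tB) (realInterval sA tA) Ξ * (2 * b * ‖Y‖) := by
    refine (norm_residual_le hBt hstB hspecBt hHh.transpose hspecHt (by positivity) hsep' hV hΞ
      hY').trans (mul_le_mul_of_nonneg_left ?_ (theta_nonneg _ _ _))
    rw [norm_neg, l2_opNorm_transpose]
    exact mul_le_mul_of_nonneg_right ((norm_mul_sub_le hV.1).trans (by linarith)) (norm_nonneg _)
  -- The diagonal parts `U H Y Vᵀ` and `U Y Kᵀ Vᵀ` differ by `U G Vᵀ = F` and cancel.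
  have hdecomp : A * galerkin A B UF VF U V - galerkin A B UF VF U V * B - F =
      N * Y * Vᵀ + U * (N' * -Yᵀ)ᵀ := by
    have h1 : A * U = N + U * H := by rw [hN]; abel
    have h2 : Vᵀ * B = N'ᵀ + Kᵀ * Vᵀ := by
      rw [hN', transpose_sub, transpose_mul, transpose_mul, transpose_transpose]; abel
    have h3 : A * (U * Y * Vᵀ) = N * Y * Vᵀ + U * (H * Y) * Vᵀ := by
      rw [← Matrix.mul_assoc, ← Matrix.mul_assoc, h1]
      simp only [Matrix.add_mul, Matrix.mul_assoc]
    have h4 : U * Y * Vᵀ * B = U * (Y * N'ᵀ) + U * (Y * Kᵀ) * Vᵀ := by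
      rw [Matrix.mul_assoc (U * Y), h2]
      simp only [Matrix.mul_add, Matrix.mul_assoc]
    have h5 : F = U * (H * Y) * Vᵀ - U * (Y * Kᵀ) * Vᵀ := by
      rw [← Matrix.sub_mul, ← Matrix.mul_sub, hY, hFG]
    rw [hX, h3, h4, h5, transpose_mul N', transpose_neg, transpose_transpose, Matrix.neg_mul,
      Matrix.mul_neg]
    abel
  have horth1 : (N * Y * Vᵀ)ᴴ * (U * (N' * -Yᵀ)ᵀ) = 0 := by
    have h : Nᴴ * U = 0 := by
      rw [← conjTranspose_conjTranspose U, ← conjTranspose_mul, hUN, conjTranspose_zero]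
    rw [conjTranspose_mul, conjTranspose_mul, Matrix.mul_assoc, Matrix.mul_assoc,
      ← Matrix.mul_assoc Nᴴ, h, Matrix.zero_mul, Matrix.mul_zero, Matrix.mul_zero]
  have horth2 : N * Y * Vᵀ * (U * (N' * -Yᵀ)ᵀ)ᴴ = 0 := by
    have h : Vᵀ * N'ᵀᴴ = 0 := by
      have h1 : N'ᴴ * V = 0 := by
        rw [← conjTranspose_conjTranspose V, ← conjTranspose_mul, hVN, conjTranspose_zero]
      have h2 : N'ᵀᴴ = N'ᴴᵀ := rfl
      rw [h2, ← transpose_mul, h1, transpose_zero]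
    rw [transpose_mul, conjTranspose_mul, conjTranspose_mul, Matrix.mul_assoc, ← Matrix.mul_assoc Vᵀ,
      ← Matrix.mul_assoc Vᵀ, h, Matrix.zero_mul, Matrix.zero_mul, Matrix.mul_zero]
  rw [hdecomp, norm_add_eq_max_of_orthogonal horth1 horth2]
  have hle1 : ‖N * Y * Vᵀ‖ ≤ ‖N * Y‖ := by
    refine (l2_opNorm_mul _ _).trans (mul_le_of_le_one_right (norm_nonneg _) ?_)
    rwa [l2_opNorm_transpose]
  have hle2 : ‖U * (N' * -Yᵀ)ᵀ‖ ≤ ‖N' * -Yᵀ‖ := by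
    refine (l2_opNorm_mul _ _).trans (mul_le_of_le_one_left (norm_nonneg _) hU1 |>.trans ?_)
    rw [l2_opNorm_transpose]
  refine max_le ?_ ?_
  · refine (hle1.trans (hblock (theta_nonneg _ _ _) hR1)).trans ?_
    gcongr
    exact le_max_left _ _
  · refine (hle2.trans (hblock (theta_nonneg _ _ _) hR2)).trans ?_
    gcongr
    exact le_max_right _ _
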